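/- For $0<u\le 1$ let $\zeta(s,u)$ be the Hurwitz zeta function, i.e. the meromorphic continuation of $\sum_{n\ge 0}(n+u)^{-s}$ ($\operatorname{Re}s>1$) to $\mathbb{C}$, and let the generalised Stieltjes constants $\gamma_p(u)$, $p\ge 0$, be defined by its Laurent expansion about $s=1$, $$\zeta(s,u)=\frac1{s-1}+\sum_{p=0}^{\infty}\frac{(-1)^p}{p!}\,\gamma_p(u)\,(s-1)^p .$$ Write $\gamma_p=\gamma_p(1)$ for the Stieltjes constants (the case of the Riemann zeta function), let $\gamma$ be Euler's constant and $\Gamma$ the gamma function. Then $$\gamma_1\!\left(\tfrac14\right)=\tfrac12\left[2\gamma_1-7\log^2 2-6\gamma\log 2\right]-\tfrac12\pi\left[\gamma+4\log 2+3\log\pi-4\log\Gamma\!\left(\tfrac14\right)\right],$$ $$\gamma_1\!\left(\tfrac34\right)=\tfrac12\left[2\gamma_1-7\log^2 2-6\gamma\log 2\right]+\tfrac12\pi\left[\gamma+4\log 2+3\log\pi-4\log\Gamma\!\left(\tfrac14\right)\right].$$ -/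

import Mathlib

open Filter Topology

/-- The function `s ↦ ζ(s, u) - 1 / (s - 1)`, where `ζ(s, u)` is the (meromorphically continued)
Hurwitz zeta function with parameter `0 < u ≤ 1`, and where the removable singularity at `s = 1`
is filled in by the limit. -/
noncomputable def hurwitzRegularPart (u : ℝ) : ℂ → ℂ :=
  Function.update (fun s : ℂ => HurwitzZeta.hurwitzZeta (u : UnitAddCircle) s - 1 / (s - 1)) 1
    (limUnder (𝓝[≠] (1 : ℂ))
      (fun s : ℂ => HurwitzZeta.hurwitzZeta (u : UnitAddCircle) s - 1 / (s - 1)))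

/-- The generalised Stieltjes constant `γ_p(u)`, for `0 < u ≤ 1`, defined by the Laurent expansion
`ζ(s, u) = 1 / (s - 1) + ∑ p, (-1) ^ p / p! * γ_p(u) * (s - 1) ^ p` about `s = 1`;
that this expansion holds is `hasSum_stieltjesGamma` below. -/
noncomputable def stieltjesGamma (p : ℕ) (u : ℝ) : ℂ :=
  (-1) ^ p * iteratedDeriv p (hurwitzRegularPart u) 1

/-- The Stieltjes constant `γ_p = γ_p(1)`; since `ζ(s, 1) = ζ(s)`, these are the coefficients of
the Laurent expansion of the Riemann zeta function, see `hasSum_stieltjesConst` below. -/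
noncomputable def stieltjesConst (p : ℕ) : ℂ := stieltjesGamma p 1

theorem differentiable_hurwitzRegularPart (u : ℝ) :
    Differentiable ℂ (hurwitzRegularPart u) := by
  set f : ℂ → ℂ := fun s => HurwitzZeta.hurwitzZeta (u : UnitAddCircle) s - 1 / (s - 1) with hf
  have hd : ∀ s : ℂ, s ≠ 1 → DifferentiableAt ℂ f s := fun s hs =>
    (HurwitzZeta.differentiableAt_hurwitzZeta _ hs).sub
      ((differentiableAt_const _).div (differentiableAt_id.sub_const _) (sub_ne_zero.2 hs))
  have hlim : ∃ l, Tendsto f (𝓝[≠] (1 : ℂ)) (𝓝 l) := by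
    have h0 := (HurwitzZeta.differentiable_hurwitzZeta_sub_hurwitzZeta
      (u : UnitAddCircle) 0).continuous.tendsto 1
    have h1 := (h0.mono_left (nhdsWithin_le_nhds (s := {1}ᶜ))).add tendsto_riemannZeta_sub_one_div
    refine ⟨_, h1.congr fun s => ?_⟩
    simp only [HurwitzZeta.hurwitzZeta_zero, hf]
    ring
  have hc : ContinuousAt (hurwitzRegularPart u) 1 := by
    rw [hurwitzRegularPart, continuousAt_update_same]
    exact tendsto_nhds_limUnder hlim
  have hd' : ∀ s : ℂ, s ≠ 1 → DifferentiableAt ℂ (hurwitzRegularPart u) s := fun s hs =>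
    (hd s hs).congr_of_eventuallyEq <| by
      filter_upwards [isOpen_ne.mem_nhds hs] with z hz
      exact Function.update_of_ne hz _ _
  intro s
  by_cases hs : s = 1
  · subst hs
    exact (Complex.analyticAt_of_differentiable_on_punctured_nhds_of_continuousAt
      (eventually_nhdsWithin_of_forall hd') hc).differentiableAt
  · exact hd' s hs

/-- The Laurent expansion of the Hurwitz zeta function about `s = 1`. -/
theorem hasSum_stieltjesGamma (u : ℝ) {s : ℂ} (hs : s ≠ 1) :
    HasSum (fun p : ℕ => (-1) ^ p / (p.factorial : ℂ) * stieltjesGamma p u * (s - 1) ^ p)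
      (HurwitzZeta.hurwitzZeta (u : UnitAddCircle) s - 1 / (s - 1)) := by
  have h := Complex.hasSum_taylorSeries_of_entire (differentiable_hurwitzRegularPart u) 1 s
  have hv : hurwitzRegularPart u s =
      HurwitzZeta.hurwitzZeta (u : UnitAddCircle) s - 1 / (s - 1) :=
    Function.update_of_ne hs _ _
  rw [hv] at h
  refine h.congr_fun fun p => ?_
  have h1 : ((-1 : ℂ) ^ p) * (-1) ^ p = 1 := by rw [← mul_pow]; simp
  simp only [stieltjesGamma, smul_eq_mul]
  linear_combination ((p.factorial : ℂ)⁻¹ * iteratedDeriv p (hurwitzRegularPart u) 1 *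
    (s - 1) ^ p) * h1

/-- The Laurent expansion of the Riemann zeta function about `s = 1`. -/
theorem hasSum_stieltjesConst {s : ℂ} (hs : s ≠ 1) :
    HasSum (fun p : ℕ => (-1) ^ p / (p.factorial : ℂ) * stieltjesConst p * (s - 1) ^ p)
      (riemannZeta s - 1 / (s - 1)) := by
  have h := hasSum_stieltjesGamma 1 hs
  rwa [AddCircle.coe_period, HurwitzZeta.hurwitzZeta_zero] at h

/-! The sum and the difference of `γ_1(1/4)` and `γ_1(3/4)` are computed separately.

Sum: the odd integers give `ζ(s,1/4) + ζ(s,3/4) = (4^s - 2^s) ζ(s)`; comparing Laurent coefficients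
at `s = 1` yields the terms in `γ_1`, `log² 2` and `γ log 2` (`stieltjesGamma_one_quarter_add`).

Difference: `ζ(s,1/4) - ζ(s,3/4)` is entire, equal to `2F(s)` with `F` the odd Hurwitz zeta function
at `1/4`; up to the factor `4^s` it is the L-function of the odd character mod 4. What is needed is
`F'(1)`. The functional equation relates `F(1 - s)` to `F(s)`, so `F(0)` and `F'(0)` suffice. These
come from a corrected Dirichlet series converging near `0` (`tsum_quarterTerm`): its derivative
there is a series of logarithms, summed by Euler's limit for `log Γ`, so that `2F'(0) = log Γ(1/4) -
log Γ(3/4)`. Reflection removes `Γ(3/4)`. -/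

/-! ### Bounds for the corrected series. -/

theorem norm_ofReal_cpow_sub_le {w : ℂ} (hw : w.re ≤ 1) {y a b : ℝ} (hy : 0 < y)
    (ha : y ≤ a) (hb : y ≤ b) :
    ‖(b : ℂ) ^ w - (a : ℂ) ^ w‖ ≤ ‖w‖ * y ^ (w.re - 1) * ‖b - a‖ := by
  refine Convex.norm_image_sub_le_of_norm_hasDerivWithin_le (s := Set.Ici y)
    (f := fun x : ℝ => (x : ℂ) ^ w) (f' := fun x : ℝ => w * (x : ℂ) ^ (w - 1))
    (fun x hx => ?_) (fun x hx => ?_) (convex_Ici y) ha hb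
  · have hx0 : 0 < x := hy.trans_le hx
    have h := ((hasDerivAt_id (x : ℂ)).cpow_const (c := w)
      (Or.inl (by simpa using hx0))).comp_ofReal
    simpa using h.hasDerivWithinAt
  · have hx0 : 0 < x := hy.trans_le hx
    rw [norm_mul, Complex.norm_cpow_eq_rpow_re_of_pos hx0, Complex.sub_re, Complex.one_re]
    gcongr ?_ * ?_
    exact Real.rpow_le_rpow_of_nonpos hy hx (by linarith)

/-- Two uses of the mean value inequality: removing the linear term leaves a second-order error,
gaining two powers of `y`. -/
theorem norm_cpow_neg_sub_sub_le {s : ℂ} (hs : -2 ≤ s.re) {y a b c : ℝ} (hy : 0 < y)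
    (ha : a ∈ Set.Icc y (y + 1)) (hb : b ∈ Set.Icc y (y + 1)) (hc : c ∈ Set.Icc y (y + 1)) :
    ‖(b : ℂ) ^ (-s) - (a : ℂ) ^ (-s) + s * (b - a) * (c : ℂ) ^ (-s - 1)‖ ≤
      ‖s‖ * (‖s + 1‖ * y ^ (-s.re - 2)) * ‖b - a‖ := by
  have key := Convex.norm_image_sub_le_of_norm_hasDerivWithin_le (s := Set.Icc y (y + 1))
    (f := fun x : ℝ => (x : ℂ) ^ (-s) + s * x * (c : ℂ) ^ (-s - 1))
    (f' := fun x : ℝ => -s * ((x : ℂ) ^ (-s - 1) - (c : ℂ) ^ (-s - 1)))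
    (C := ‖s‖ * (‖s + 1‖ * y ^ (-s.re - 2))) (fun x hx => ?_) (fun x hx => ?_)
    (convex_Icc _ _) ha hb
  · refine le_of_eq_of_le (congrArg norm ?_) key
    ring
  · have hx0 : 0 < x := hy.trans_le hx.1
    have h := (((hasDerivAt_id (x : ℂ)).cpow_const (c := -s)
      (Or.inl (by simpa using hx0))).add
      (((hasDerivAt_id (x : ℂ)).const_mul s).mul_const ((c : ℂ) ^ (-s - 1)))).comp_ofReal
    refine (h.congr_deriv ?_).hasDerivWithinAt
    simp only [id, mul_one]
    ring
  · rw [norm_mul, norm_neg]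
    gcongr
    have h := norm_ofReal_cpow_sub_le (w := -s - 1) (by simp; linarith) hy hc.1 hx.1
    refine h.trans ?_
    have e1 : ‖-s - 1‖ = ‖s + 1‖ := by rw [← norm_neg]; congr 1; ring
    have e2 : (-s - 1).re - 1 = -s.re - 2 := by simp; ring
    rw [e1, e2]
    refine mul_le_of_le_one_right (by positivity) ?_
    rw [Real.norm_eq_abs, abs_le]
    constructor <;> linarith [hx.1, hx.2, hc.1, hc.2]

/-- `(n + 1/4)⁻ˢ - (n + 3/4)⁻ˢ`, corrected to become summable near `s = 0`. -/
noncomputable def quarterTerm (n : ℕ) (s : ℂ) : ℂ :=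
  ((n + 1 / 4 : ℝ) : ℂ) ^ (-s) - ((n + 3 / 4 : ℝ) : ℂ) ^ (-s)
    - s / 2 * ((n + 1 : ℝ) : ℂ) ^ (-s - 1)

/-- The ball is connected, contains `0`, and has its centre in `1 < re s`. On it `-1/2 < re s`, so
the second-order error decays like `n ^ (-3/2)`. -/
theorem norm_quarterTerm_le (n : ℕ) {s : ℂ} (hs : s ∈ Metric.ball (2 : ℂ) (5 / 2)) :
    ‖quarterTerm n s‖ ≤ 9 / 2 * (11 / 2 * 4 ^ (7 : ℝ)) / 2 * ((n + 1 : ℝ) ^ (3 / 2 : ℝ))⁻¹ := by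
  rw [Metric.mem_ball, dist_eq_norm] at hs
  have hre : |s.re - 2| < 5 / 2 := by
    simpa using (Complex.abs_re_le_norm (s - 2)).trans_lt hs
  rw [abs_lt] at hre
  have hn : ‖s‖ ≤ 9 / 2 := by
    have := norm_add_le (s - 2) 2
    simp only [sub_add_cancel, Complex.norm_ofNat] at this
    linarith
  have hn1 : ‖s + 1‖ ≤ 11 / 2 := by
    have := norm_add_le s 1
    simp only [norm_one] at this
    linarith
  have hy : (0 : ℝ) < n + 1 / 4 := by positivity
  have h := norm_cpow_neg_sub_sub_le (s := s) (by linarith) hy (a := n + 3 / 4) (b := n + 1 / 4)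
    (c := n + 1) ⟨by linarith, by linarith⟩ ⟨by linarith, by linarith⟩ ⟨by linarith, by linarith⟩
  have e : quarterTerm n s = ((n + 1 / 4 : ℝ) : ℂ) ^ (-s) - ((n + 3 / 4 : ℝ) : ℂ) ^ (-s)
      + s * (((n + 1 / 4 : ℝ) : ℂ) - ((n + 3 / 4 : ℝ) : ℂ)) * ((n + 1 : ℝ) : ℂ) ^ (-s - 1) := by
    rw [quarterTerm]
    generalize ((n + 1 : ℝ) : ℂ) ^ (-s - 1) = z
    generalize ((n + 1 / 4 : ℝ) : ℂ) ^ (-s) = z1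
    generalize ((n + 3 / 4 : ℝ) : ℂ) ^ (-s) = z2
    push_cast
    ring
  -- Since `n + 1/4 ≥ (n + 1)/4`, the loss is `4 ^ (re s + 2)`, and `re s + 2 < 13/2 < 7`.
  have hr : (n + 1 / 4 : ℝ) ^ (-s.re - 2) ≤ 4 ^ (7 : ℝ) * ((n + 1 : ℝ) ^ (3 / 2 : ℝ))⁻¹ := by
    have h1 : (n + 1 / 4 : ℝ) ^ (-s.re - 2) ≤ ((n + 1 : ℝ) / 4) ^ (-s.re - 2) :=
      Real.rpow_le_rpow_of_nonpos (by positivity) (by linarith) (by linarith)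
    refine h1.trans ?_
    rw [Real.div_rpow (by positivity) (by norm_num), div_eq_mul_inv _ ((4 : ℝ) ^ (_ : ℝ)),
      ← Real.rpow_neg (by norm_num : (0 : ℝ) ≤ 4), mul_comm,
      ← Real.rpow_neg (by positivity : (0 : ℝ) ≤ n + 1)]
    have hn0 : (0 : ℝ) ≤ n := n.cast_nonneg
    gcongr <;> linarith
  have hd : ‖(n + 1 / 4 : ℝ) - (n + 3 / 4)‖ = 1 / 2 := by
    rw [show (n + 1 / 4 : ℝ) - (n + 3 / 4) = -(1 / 2) by ring]; norm_num
  rw [e]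
  rw [hd] at h
  refine h.trans ?_
  calc _ ≤ 9 / 2 * (11 / 2 * (4 ^ (7 : ℝ) * ((n + 1 : ℝ) ^ (3 / 2 : ℝ))⁻¹)) * (1 / 2) := by
        gcongr
    _ = _ := by ring

theorem summable_quarterTerm_bound :
    Summable fun n : ℕ =>
      (9 / 2 * (11 / 2 * 4 ^ (7 : ℝ)) / 2 * ((n + 1 : ℝ) ^ (3 / 2 : ℝ))⁻¹ : ℝ) := by
  refine Summable.mul_left _ ?_
  have h := (summable_nat_add_iff 1).2 (Real.summable_nat_rpow_inv.2 (by norm_num : (1 : ℝ) < 3 / 2))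
  simpa using h

theorem hasDerivAt_quarterTerm (n : ℕ) (s : ℂ) :
    HasDerivAt (quarterTerm n)
      (-((n + 1 / 4 : ℝ) : ℂ) ^ (-s) * Complex.log (n + 1 / 4 : ℝ)
        + ((n + 3 / 4 : ℝ) : ℂ) ^ (-s) * Complex.log (n + 3 / 4 : ℝ)
        - (1 / 2 * ((n + 1 : ℝ) : ℂ) ^ (-s - 1)
          - s / 2 * (((n + 1 : ℝ) : ℂ) ^ (-s - 1) * Complex.log (n + 1 : ℝ)))) s := by
  have aux : ∀ x : ℝ, 0 < x → (x : ℂ) ≠ 0 := fun x hx => Complex.ofReal_ne_zero.2 hx.ne'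
  have h1 := (hasDerivAt_neg s).const_cpow
    (Or.inl (aux (n + 1 / 4) (by positivity)))
  have h2 := (hasDerivAt_neg s).const_cpow
    (Or.inl (aux (n + 3 / 4) (by positivity)))
  have h3 := ((hasDerivAt_neg s).sub_const 1).const_cpow
    (Or.inl (aux (n + 1) (by positivity)))
  have h := (h1.sub h2).sub (((hasDerivAt_id s).div_const 2).mul h3)
  refine h.congr_deriv ?_
  simp only [id]
  ring

/-! ### Sum and difference of the Hurwitz zeta functions at `1/4` and `3/4`. -/

theorem hurwitzRegularPart_of_ne {u : ℝ} {s : ℂ} (hs : s ≠ 1) :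
    hurwitzRegularPart u s = HurwitzZeta.hurwitzZeta (u : UnitAddCircle) s - 1 / (s - 1) :=
  Function.update_of_ne hs _ _

theorem hurwitzRegularPart_one_of_ne {s : ℂ} (hs : s ≠ 1) :
    hurwitzRegularPart 1 s = riemannZeta s - 1 / (s - 1) := by
  rw [hurwitzRegularPart_of_ne hs, AddCircle.coe_period, HurwitzZeta.hurwitzZeta_zero]

theorem hurwitzRegularPart_one_one :
    hurwitzRegularPart 1 1 = Real.eulerMascheroniConstant := by
  have h1 : Tendsto (hurwitzRegularPart 1) (𝓝[≠] 1) (𝓝 (hurwitzRegularPart 1 1)) :=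
    ((differentiable_hurwitzRegularPart 1).continuous.tendsto 1).mono_left nhdsWithin_le_nhds
  refine tendsto_nhds_unique (h1.congr' ?_) tendsto_riemannZeta_sub_one_div
  filter_upwards [self_mem_nhdsWithin] with s hs using hurwitzRegularPart_one_of_ne hs

theorem stieltjesGamma_one (u : ℝ) :
    stieltjesGamma 1 u = -deriv (hurwitzRegularPart u) 1 := by
  simp [stieltjesGamma, iteratedDeriv_one]

theorem hurwitzZeta_three_quarters (s : ℂ) :
    HurwitzZeta.hurwitzZeta ((3 / 4 : ℝ) : UnitAddCircle) s =
      HurwitzZeta.hurwitzZeta ((1 / 4 : ℝ) : UnitAddCircle) s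
        - 2 * HurwitzZeta.hurwitzZetaOdd ((1 / 4 : ℝ) : UnitAddCircle) s := by
  have h : ((3 / 4 : ℝ) : UnitAddCircle) = -((1 / 4 : ℝ) : UnitAddCircle) := by
    rw [eq_neg_iff_add_eq_zero, ← AddCircle.coe_add, ← AddCircle.coe_period]
    norm_num
  rw [HurwitzZeta.hurwitzZetaOdd_eq, h]
  ring

theorem hurwitzRegularPart_quarter_sub (s : ℂ) :
    hurwitzRegularPart (1 / 4) s - hurwitzRegularPart (3 / 4) s =
      2 * HurwitzZeta.hurwitzZetaOdd ((1 / 4 : ℝ) : UnitAddCircle) s := by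
  refine congrFun (Continuous.ext_on (dense_compl_singleton (1 : ℂ))
    ((differentiable_hurwitzRegularPart _).continuous.sub
      (differentiable_hurwitzRegularPart _).continuous)
    ((HurwitzZeta.differentiable_hurwitzZetaOdd _).continuous.const_smul (2 : ℂ)) ?_) s
  intro z hz
  simp only [Pi.sub_apply, hurwitzRegularPart_of_ne hz, hurwitzZeta_three_quarters, Pi.smul_apply, smul_eq_mul]
  ring

theorem toAddCircle_four (j : ZMod 4) :
    ZMod.toAddCircle j = ((j.val / 4 : ℝ) : UnitAddCircle) := by
  rw [ZMod.toAddCircle_apply]; norm_num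

theorem four_cpow_eq (s : ℂ) : (4 : ℂ) ^ s = 2 ^ s * 2 ^ s := by
  have h := Complex.natCast_mul_natCast_cpow 2 2 s
  norm_num at h
  exact h

/-- The L-function of the trivial character mod 4 has two expressions: a sum over the units `1, 3`,
and `ζ` without its Euler factor at `2`. -/
theorem hurwitzZeta_quarter_add {s : ℂ} (hs : s ≠ 1) :
    HurwitzZeta.hurwitzZeta ((1 / 4 : ℝ) : UnitAddCircle) s
      + HurwitzZeta.hurwitzZeta ((3 / 4 : ℝ) : UnitAddCircle) s =
      (4 ^ s - 2 ^ s) * riemannZeta s := by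
  have h := DirichletCharacter.LFunctionTrivChar_eq_mul_riemannZeta (N := 4) hs
  have hp : Nat.primeFactors 4 = {2} := by
    rw [show 4 = 2 ^ 2 by norm_num, Nat.primeFactors_prime_pow (by norm_num) Nat.prime_two]
  have h0 : ¬ IsUnit (0 : ZMod 4) := by decide
  have h2 : ¬ IsUnit (2 : ZMod 4) := by decide
  have h1 : IsUnit (1 : ZMod 4) := by decide
  have h3 : IsUnit (3 : ZMod 4) := by decide
  have hsum : ∀ f : ZMod 4 → ℂ, ∑ j, f j = f 0 + f 1 + f 2 + f 3 := fun f => Fin.sum_univ_four f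
  rw [DirichletCharacter.LFunctionTrivChar, DirichletCharacter.LFunction, ZMod.LFunction, hp,
    Finset.prod_singleton, hsum, MulChar.map_nonunit _ h0, MulChar.map_nonunit _ h2,
    MulChar.one_apply h1, MulChar.one_apply h3] at h
  simp only [toAddCircle_four, zero_mul, one_mul, zero_add, add_zero] at h
  have v1 : (1 : ZMod 4).val = 1 := rfl
  have v3 : (3 : ZMod 4).val = 3 := rfl
  rw [v1, v3] at h
  push_cast at h
  have h4 : (2 : ℂ) ^ s ≠ 0 := by simp [Complex.cpow_eq_zero_iff]
  rw [Complex.cpow_neg, Complex.cpow_neg, four_cpow_eq] at h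
  rw [four_cpow_eq]
  field_simp at h
  linear_combination h

/-- Finite Fourier analysis mod 4: `expZeta` at `±1/4` is the L-function of `j ↦ (±i)^j`. In the
difference the even residues cancel, leaving the residues `1` and `3` with opposite signs. -/
theorem sinZeta_quarter (s : ℂ) :
    HurwitzZeta.sinZeta ((1 / 4 : ℝ) : UnitAddCircle) s =
      4 ^ (-s) * (2 * HurwitzZeta.hurwitzZetaOdd ((1 / 4 : ℝ) : UnitAddCircle) s) := by
  have hsum : ∀ f : ZMod 4 → ℂ, ∑ j, f j = f 0 + f 1 + f 2 + f 3 := fun f => Fin.sum_univ_four f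
  have e0 : ZMod.stdAddChar (0 : ZMod 4) = 1 := AddChar.map_zero_eq_one _
  have e1 : ZMod.stdAddChar (1 : ZMod 4) = Complex.I := by
    have h := ZMod.stdAddChar_coe (N := 4) 1
    rw [Int.cast_one] at h
    refine h.trans (Eq.trans (congrArg _ ?_) Complex.exp_pi_div_two_mul_I)
    push_cast
    ring
  have e2 : ZMod.stdAddChar (2 : ZMod 4) = -1 := by
    rw [show (2 : ZMod 4) = 1 + 1 by decide, AddChar.map_add_eq_mul, e1, Complex.I_mul_I]
  have e3 : ZMod.stdAddChar (3 : ZMod 4) = -Complex.I := by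
    rw [show (3 : ZMod 4) = 2 + 1 by decide, AddChar.map_add_eq_mul, e1, e2, neg_one_mul]
  have h1 := ZMod.LFunction_stdAddChar_eq_expZeta (1 : ZMod 4) s (Or.inl (by decide))
  have h3 := ZMod.LFunction_stdAddChar_eq_expZeta (-1 : ZMod 4) s (Or.inl (by decide))
  have v1 : ZMod.toAddCircle (1 : ZMod 4) = ((1 / 4 : ℝ) : UnitAddCircle) := by
    rw [toAddCircle_four]; norm_num [show (1 : ZMod 4).val = 1 from rfl]
  have v3 : ZMod.toAddCircle (3 : ZMod 4) = ((3 / 4 : ℝ) : UnitAddCircle) := by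
    rw [toAddCircle_four]; norm_num [show (3 : ZMod 4).val = 3 from rfl]
  rw [ZMod.LFunction, hsum] at h1 h3
  rw [map_neg] at h3
  simp only [show (-1 : ZMod 4) * 0 = 0 by decide, show (-1 : ZMod 4) * 1 = 3 by decide,
    show (-1 : ZMod 4) * 2 = 2 by decide, show (-1 : ZMod 4) * 3 = 1 by decide, mul_zero, one_mul,
    e0, e1, e2, e3, v1, v3, hurwitzZeta_three_quarters] at h1 h3
  rw [HurwitzZeta.sinZeta_eq, ← h1, ← h3, div_eq_iff (by simp)]
  push_cast
  ring

theorem hurwitzRegularPart_quarter_add_identity (s : ℂ) :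
    (s - 1) * (hurwitzRegularPart (1 / 4) s + hurwitzRegularPart (3 / 4) s) + 2 =
      (4 ^ s - 2 ^ s) * ((s - 1) * hurwitzRegularPart 1 s + 1) := by
  by_cases hs : s = 1
  · subst hs; norm_num
  · have h := hurwitzZeta_quarter_add hs
    have hs' : s - 1 ≠ 0 := sub_ne_zero.2 hs
    rw [hurwitzRegularPart_one_of_ne hs, hurwitzRegularPart_of_ne hs, hurwitzRegularPart_of_ne hs]
    field_simp
    linear_combination (s - 1) * h

/-- Second derivatives of both sides at `s = 1`; the identity has its poles cleared, so no limit is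
needed. -/
theorem two_mul_deriv_of_identity {f g A A' : ℂ → ℂ} {A'' : ℂ} (hf : Differentiable ℂ f)
    (hg : Differentiable ℂ g) (hA : ∀ s, HasDerivAt A (A' s) s) (hA' : HasDerivAt A' A'' 1)
    (h : ∀ s, (s - 1) * f s + 2 = A s * ((s - 1) * g s + 1)) :
    2 * deriv f 1 = A'' + 2 * A' 1 * g 1 + 2 * A 1 * deriv g 1 := by
  have hid : ∀ s : ℂ, HasDerivAt (fun z : ℂ => z - 1) 1 s := fun s => (hasDerivAt_id s).sub_const 1
  have h1 : ∀ s, f s + (s - 1) * deriv f s =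
      A' s * ((s - 1) * g s + 1) + A s * (g s + (s - 1) * deriv g s) := by
    intro s
    have l := ((hid s).mul (hf s).hasDerivAt).add_const 2
    have r := (hA s).mul (((hid s).mul (hg s).hasDerivAt).add_const 1)
    have e := l.unique (r.congr_of_eventuallyEq (Eventually.of_forall h))
    simpa using e
  have l := (hf 1).hasDerivAt.add ((hid 1).mul (hf.deriv 1).hasDerivAt)
  have r := (hA'.mul (((hid 1).mul (hg 1).hasDerivAt).add_const 1)).add
    ((hA 1).mul ((hg 1).hasDerivAt.add ((hid 1).mul (hg.deriv 1).hasDerivAt)))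
  have e := l.unique (r.congr_of_eventuallyEq (Eventually.of_forall h1))
  simp only [sub_self, Pi.mul_apply, Pi.add_apply] at e
  linear_combination e

theorem complex_log_two : Complex.log 2 = (Real.log 2 : ℂ) := by
  rw [Complex.ofReal_log (by norm_num)]; norm_num

theorem complex_log_four : Complex.log 4 = 2 * (Real.log 2 : ℂ) := by
  rw [← Complex.ofReal_ofNat 4, ← Complex.ofReal_log (by norm_num),
    show (4 : ℝ) = 2 ^ 2 by norm_num, Real.log_pow]
  push_cast; ring

theorem stieltjesGamma_one_quarter_add :
    stieltjesGamma 1 (1 / 4) + stieltjesGamma 1 (3 / 4) =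
      2 * stieltjesConst 1 - 7 * (Real.log 2 : ℂ) ^ 2
        - 6 * (Real.eulerMascheroniConstant : ℂ) * (Real.log 2 : ℂ) := by
  have hpow : ∀ (b : ℂ), b ≠ 0 → ∀ s, HasDerivAt (fun z : ℂ => b ^ z) (b ^ s * Complex.log b) s :=
    fun b hb s => by simpa using (hasDerivAt_id s).const_cpow (Or.inl hb)
  have h := two_mul_deriv_of_identity
    ((differentiable_hurwitzRegularPart (1 / 4)).add (differentiable_hurwitzRegularPart (3 / 4)))
    (differentiable_hurwitzRegularPart 1)
    (fun s => (hpow 4 (by norm_num) s).sub (hpow 2 (by norm_num) s))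
    (((hpow 4 (by norm_num) 1).mul_const (Complex.log 4)).sub
      ((hpow 2 (by norm_num) 1).mul_const (Complex.log 2)))
    hurwitzRegularPart_quarter_add_identity
  rw [deriv_add (differentiable_hurwitzRegularPart _ _) (differentiable_hurwitzRegularPart _ _),
    hurwitzRegularPart_one_one, complex_log_two, complex_log_four] at h
  simp only [Complex.cpow_one, Pi.sub_apply] at h
  rw [stieltjesConst, stieltjesGamma_one, stieltjesGamma_one, stieltjesGamma_one]
  linear_combination (-1 / 2) * h

theorem stieltjesGamma_one_quarter_sub :
    stieltjesGamma 1 (1 / 4) - stieltjesGamma 1 (3 / 4) =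
      -2 * deriv (HurwitzZeta.hurwitzZetaOdd ((1 / 4 : ℝ) : UnitAddCircle)) 1 := by
  have h := congrArg (deriv · 1) (funext hurwitzRegularPart_quarter_sub)
  rw [deriv_fun_sub (differentiable_hurwitzRegularPart _ _) (differentiable_hurwitzRegularPart _ _),
    deriv_const_mul _ (HurwitzZeta.differentiable_hurwitzZetaOdd _ _)] at h
  rw [stieltjesGamma_one, stieltjesGamma_one]
  linear_combination -h

/-! ### Value and derivative of the odd zeta function at `s = 0`. -/

theorem hasSum_quarterTerm_of_one_lt_re {s : ℂ} (hs : 1 < s.re) :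
    HasSum (fun n => quarterTerm n s)
      (2 * HurwitzZeta.hurwitzZetaOdd ((1 / 4 : ℝ) : UnitAddCircle) s
        - s / 2 * riemannZeta (s + 1)) := by
  have h1 := (HurwitzZeta.hasSum_nat_hurwitzZetaOdd_of_mem_Icc
    (a := 1 / 4) ⟨by norm_num, by norm_num⟩ hs).mul_left 2
  have hs1 : 1 < (s + 1).re := by simp; linarith
  have h2 : HasSum (fun n : ℕ => 1 / (n + 1 : ℂ) ^ (s + 1)) (riemannZeta (s + 1)) := by
    rw [zeta_eq_tsum_one_div_nat_add_one_cpow hs1]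
    have h := (summable_nat_add_iff 1).2 (Complex.summable_one_div_nat_cpow.2 hs1)
    simpa using h.hasSum
  refine (h1.sub (h2.mul_left (s / 2))).congr_fun fun n => ?_
  rw [quarterTerm, show -s - 1 = -(s + 1) by ring, Complex.cpow_neg, Complex.cpow_neg,
    Complex.cpow_neg]
  have e : (n + 1 - ((1 / 4 : ℝ) : ℂ)) = ((n + 3 / 4 : ℝ) : ℂ) := by push_cast; ring
  rw [e]
  push_cast
  ring

/-- Analytic continuation from `1 < re s`. Writing `s ζ(s + 1)` as `1 + s * hurwitzRegularPart 1 (s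
+ 1)` makes the right side entire, in particular regular at `0`. -/
theorem tsum_quarterTerm {s : ℂ} (hs : s ∈ Metric.ball (2 : ℂ) (5 / 2)) :
    ∑' n, quarterTerm n s =
      2 * HurwitzZeta.hurwitzZetaOdd ((1 / 4 : ℝ) : UnitAddCircle) s
        - (1 + s * hurwitzRegularPart 1 (s + 1)) / 2 := by
  have hl : DifferentiableOn ℂ (fun s => ∑' n, quarterTerm n s) (Metric.ball (2 : ℂ) (5 / 2)) :=
    Complex.differentiableOn_tsum_of_summable_norm summable_quarterTerm_bound
      (fun n s _ => (hasDerivAt_quarterTerm n s).differentiableAt.differentiableWithinAt)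
      Metric.isOpen_ball fun n s hs => norm_quarterTerm_le n hs
  have hr : Differentiable ℂ fun s : ℂ =>
      2 * HurwitzZeta.hurwitzZetaOdd ((1 / 4 : ℝ) : UnitAddCircle) s
        - (1 + s * hurwitzRegularPart 1 (s + 1)) / 2 :=
    ((HurwitzZeta.differentiable_hurwitzZetaOdd _).const_mul 2).sub
      (((differentiable_id.mul ((differentiable_hurwitzRegularPart 1).comp
        (differentiable_id.add_const 1))).const_add 1).div_const 2)
  refine (hl.analyticOnNhd Metric.isOpen_ball).eqOn_of_preconnected_of_eventuallyEq
    (hr.differentiableOn.analyticOnNhd Metric.isOpen_ball)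
    (convex_ball (2 : ℂ) (5 / 2)).isPreconnected (Metric.mem_ball_self (by norm_num)) ?_ hs
  have hopen : IsOpen {z : ℂ | 1 < z.re} := isOpen_lt continuous_const Complex.continuous_re
  filter_upwards [hopen.mem_nhds (show (1 : ℝ) < (2 : ℂ).re by norm_num)] with z hz
  have hz0 : z ≠ 0 := by
    rintro rfl
    simp at hz
    linarith
  rw [(hasSum_quarterTerm_of_one_lt_re hz).tsum_eq,
    hurwitzRegularPart_one_of_ne (by simpa using hz0), add_sub_cancel_right]
  field_simp
  ring

theorem zero_mem_ball : (0 : ℂ) ∈ Metric.ball (2 : ℂ) (5 / 2) := by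
  rw [Metric.mem_ball, dist_eq_norm]; norm_num

theorem hurwitzZetaOdd_quarter_zero :
    HurwitzZeta.hurwitzZetaOdd ((1 / 4 : ℝ) : UnitAddCircle) 0 = 1 / 4 := by
  have h := tsum_quarterTerm zero_mem_ball
  have h0 : ∀ n, quarterTerm n 0 = 0 := fun n => by simp [quarterTerm]
  simp only [h0, tsum_zero, zero_mul, add_zero] at h
  linear_combination (-1 / 2) * h

theorem hasSum_log_quarter :
    HasSum (fun n : ℕ => ((Real.log (n + 3 / 4) - Real.log (n + 1 / 4) - 1 / (2 * (n + 1)) : ℝ) : ℂ))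
      (2 * deriv (HurwitzZeta.hurwitzZetaOdd ((1 / 4 : ℝ) : UnitAddCircle)) 0
        - Real.eulerMascheroniConstant / 2) := by
  have h := Complex.hasSum_deriv_of_summable_norm summable_quarterTerm_bound
      (fun n s _ => (hasDerivAt_quarterTerm n s).differentiableAt.differentiableWithinAt)
      Metric.isOpen_ball (fun n s hs => norm_quarterTerm_le n hs) zero_mem_ball
  have hd : HasDerivAt (fun s : ℂ => 2 * HurwitzZeta.hurwitzZetaOdd ((1 / 4 : ℝ) : UnitAddCircle) s
        - (1 + s * hurwitzRegularPart 1 (s + 1)) / 2)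
      (2 * deriv (HurwitzZeta.hurwitzZetaOdd ((1 / 4 : ℝ) : UnitAddCircle)) 0
        - (1 * hurwitzRegularPart 1 (0 + 1) + 0 * deriv (hurwitzRegularPart 1) (0 + 1)) / 2) 0 :=
    ((HurwitzZeta.differentiable_hurwitzZetaOdd _ _).hasDerivAt.const_mul 2).sub
      ((((hasDerivAt_id 0).mul ((differentiable_hurwitzRegularPart 1 (0 + 1)).hasDerivAt.comp_add_const
        0 1)).const_add 1).div_const 2)
  have he : (fun w : ℂ => ∑' n, quarterTerm n w) =ᶠ[𝓝 0] fun s : ℂ =>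
      2 * HurwitzZeta.hurwitzZetaOdd ((1 / 4 : ℝ) : UnitAddCircle) s
        - (1 + s * hurwitzRegularPart 1 (s + 1)) / 2 := by
    filter_upwards [Metric.isOpen_ball.mem_nhds zero_mem_ball] with s hs using tsum_quarterTerm hs
  rw [he.deriv_eq, hd.deriv, zero_add, hurwitzRegularPart_one_one, one_mul, zero_mul, add_zero] at h
  refine h.congr_fun fun n => ?_
  rw [(hasDerivAt_quarterTerm n 0).deriv, ← Complex.ofReal_log (by positivity),
    ← Complex.ofReal_log (by positivity)]
  simp only [neg_zero, Complex.cpow_zero, zero_sub, Complex.cpow_neg_one]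
  push_cast
  have : (n + 1 : ℂ) ≠ 0 := Nat.cast_add_one_ne_zero n
  field_simp
  ring

theorem tendsto_sum_log_quarter :
    Tendsto (fun n : ℕ => ∑ m ∈ Finset.range n,
        (Real.log (m + 3 / 4) - Real.log (m + 1 / 4) - 1 / (2 * (m + 1)))) atTop
      (𝓝 (Real.log (Real.Gamma (1 / 4)) - Real.log (Real.Gamma (3 / 4))
        - Real.eulerMascheroniConstant / 2)) := by
  rw [← tendsto_add_atTop_iff_nat 1]
  have h1 := Real.BohrMollerup.tendsto_log_gamma (x := 1 / 4) (by norm_num)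
  have h2 := Real.BohrMollerup.tendsto_log_gamma (x := 3 / 4) (by norm_num)
  have h3 := (tendsto_add_atTop_iff_nat 1).2 Real.tendsto_harmonic_sub_log
  -- `logGammaSeq x n` has `n + 1` logarithms but the term `x * log n`, whereas `H_{n+1}` is paired
  -- with `log (n + 1)`; this limit absorbs the mismatch.
  have h4 := Real.tendsto_log_nat_add_one_sub_log
  have h := ((h1.sub h2).sub (h3.div_const 2)).sub (h4.div_const 2)
  rw [zero_div, sub_zero] at h
  refine h.congr fun n => ?_
  have hh : ((harmonic (n + 1) : ℚ) : ℝ) = ∑ m ∈ Finset.range (n + 1), 1 / (m + 1 : ℝ) := by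
    rw [harmonic]; push_cast; simp
  simp only [Real.BohrMollerup.logGammaSeq, Finset.sum_sub_distrib, hh]
  have e : ∑ m ∈ Finset.range (n + 1), 1 / (2 * (m + 1 : ℝ)) =
      (∑ m ∈ Finset.range (n + 1), 1 / (m + 1 : ℝ)) / 2 := by
    rw [Finset.sum_div]
    refine Finset.sum_congr rfl fun m _ => ?_
    rw [div_div, mul_comm]
  rw [e]
  simp only [add_comm (_ : ℝ) (1 / 4 : ℝ), add_comm (_ : ℝ) (3 / 4 : ℝ)]
  push_cast
  ring

theorem deriv_hurwitzZetaOdd_quarter_zero :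
    2 * deriv (HurwitzZeta.hurwitzZetaOdd ((1 / 4 : ℝ) : UnitAddCircle)) 0 =
      (Real.log (Real.Gamma (1 / 4)) - Real.log (Real.Gamma (3 / 4)) : ℝ) := by
  have h1 := hasSum_log_quarter.tendsto_sum_nat
  have h2 := (Complex.continuous_ofReal.tendsto _).comp tendsto_sum_log_quarter
  have h := tendsto_nhds_unique h1 (h2.congr fun n => by simp)
  push_cast at h ⊢
  linear_combination h

theorem log_Gamma_three_quarters :
    Real.log (Real.Gamma (3 / 4)) =
      Real.log Real.pi + Real.log 2 / 2 - Real.log (Real.Gamma (1 / 4)) := by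
  have h := Real.Gamma_mul_Gamma_one_sub (1 / 4)
  rw [show (1 - 1 / 4 : ℝ) = 3 / 4 by norm_num, show Real.pi * (1 / 4) = Real.pi / 4 by ring,
    Real.sin_pi_div_four] at h
  have hl := congrArg Real.log h
  have hp := Real.pi_pos
  rw [Real.log_mul (Real.Gamma_pos_of_pos (by norm_num)).ne'
    (Real.Gamma_pos_of_pos (by norm_num)).ne', Real.log_div hp.ne' (by positivity),
    Real.log_div (by positivity) (by norm_num), Real.log_sqrt (by norm_num)] at hl
  linarith

/-! ### Passage from `s = 0` to `s = 1` by the functional equation. -/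

/-- Hurwitz's formula usually leads to the sine zeta function; at `1/4`, `sinZeta_quarter` turns
that back into the odd zeta function. -/
theorem hurwitzZetaOdd_quarter_one_sub {s : ℂ} (hs : ∀ n : ℕ, s ≠ -n) :
    HurwitzZeta.hurwitzZetaOdd ((1 / 4 : ℝ) : UnitAddCircle) (1 - s) =
      4 * ((8 * Real.pi : ℝ) : ℂ) ^ (-s) * Complex.Gamma s * Complex.sin (Real.pi * s / 2)
        * HurwitzZeta.hurwitzZetaOdd ((1 / 4 : ℝ) : UnitAddCircle) s := by
  have h : ((8 * Real.pi : ℝ) : ℂ) ^ (-s) = (2 * Real.pi) ^ (-s) * 4 ^ (-s) := by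
    rw [show 8 * Real.pi = (2 * Real.pi) * 4 by ring, Complex.ofReal_mul,
      Complex.mul_cpow_ofReal_nonneg Real.two_pi_pos.le (by norm_num)]
    push_cast
    ring
  rw [HurwitzZeta.hurwitzZetaOdd_one_sub _ hs, sinZeta_quarter, h]
  ring

theorem hurwitzZetaOdd_quarter_one :
    HurwitzZeta.hurwitzZetaOdd ((1 / 4 : ℝ) : UnitAddCircle) 1 = Real.pi / 2 := by
  have h := hurwitzZetaOdd_quarter_one_sub (s := 1) fun n h => by
    have := congrArg Complex.re h
    simp at this
    linarith [(n.cast_nonneg : (0 : ℝ) ≤ n)]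
  have hp : (Real.pi : ℂ) ≠ 0 := Complex.ofReal_ne_zero.2 Real.pi_ne_zero
  rw [sub_self, hurwitzZetaOdd_quarter_zero, Complex.Gamma_one, mul_one, mul_one,
    Complex.sin_pi_div_two, mul_one, Complex.cpow_neg_one] at h
  push_cast at h
  field_simp at h
  linear_combination (-1 / 16) * h

/-- Differentiating the functional equation at `s = 1`: the sine factor contributes nothing because
`cos (π/2) = 0`, `Γ'(1) = -γ` supplies `γ`, and `(8π)^(-s)` supplies `log (8π)`. -/
theorem deriv_hurwitzZetaOdd_quarter_one :
    deriv (HurwitzZeta.hurwitzZetaOdd ((1 / 4 : ℝ) : UnitAddCircle)) 1 =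
      Real.pi / 2 * (Real.eulerMascheroniConstant + 4 * Real.log 2 + 3 * Real.log Real.pi
        - 4 * Real.log (Real.Gamma (1 / 4))) := by
  have hp : (Real.pi : ℂ) ≠ 0 := Complex.ofReal_ne_zero.2 Real.pi_ne_zero
  have h8 : ((8 * Real.pi : ℝ) : ℂ) ≠ 0 := Complex.ofReal_ne_zero.2 (by positivity)
  set F := HurwitzZeta.hurwitzZetaOdd ((1 / 4 : ℝ) : UnitAddCircle) with hF
  have hFd : Differentiable ℂ F := HurwitzZeta.differentiable_hurwitzZetaOdd _
  have l : HasDerivAt (fun s => F (1 - s)) (-deriv F (1 - 1)) 1 :=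
    (hFd _).hasDerivAt.comp_const_sub 1 1
  have d1 : HasDerivAt (fun s : ℂ => 4 * ((8 * Real.pi : ℝ) : ℂ) ^ (-s))
      (4 * (((8 * Real.pi : ℝ) : ℂ) ^ (-1 : ℂ) * Complex.log (8 * Real.pi : ℝ) * -1)) 1 :=
    ((hasDerivAt_neg 1).const_cpow (Or.inl h8)).const_mul 4
  have d2 : HasDerivAt (fun s : ℂ => Complex.sin (Real.pi * s / 2))
      (Complex.cos (Real.pi * 1 / 2) * (Real.pi * 1 / 2)) 1 :=
    (((hasDerivAt_id (1 : ℂ)).const_mul (Real.pi : ℂ)).div_const 2).csin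
  have r := ((d1.mul Complex.hasDerivAt_Gamma_one).mul d2).mul (hFd 1).hasDerivAt
  have he : (fun s => F (1 - s)) =ᶠ[𝓝 1] fun s =>
      4 * ((8 * Real.pi : ℝ) : ℂ) ^ (-s) * Complex.Gamma s * Complex.sin (Real.pi * s / 2) * F s := by
    have hopen : IsOpen {z : ℂ | 0 < z.re} := isOpen_lt continuous_const Complex.continuous_re
    filter_upwards [hopen.mem_nhds (show (0 : ℝ) < (1 : ℂ).re by norm_num)] with s hs
    refine hurwitzZetaOdd_quarter_one_sub fun n h => ?_
    rw [h] at hs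
    simp at hs
    linarith [(n.cast_nonneg : (0 : ℝ) ≤ n)]
  have e := l.unique (r.congr_of_eventuallyEq he)
  have h0 := deriv_hurwitzZetaOdd_quarter_zero
  rw [← hF, log_Gamma_three_quarters] at h0
  have hlog : Complex.log (8 * Real.pi : ℝ) = 3 * Real.log 2 + Real.log Real.pi := by
    rw [← Complex.ofReal_log (by positivity), Real.log_mul (by norm_num) Real.pi_ne_zero,
      show (8 : ℝ) = 2 ^ 3 by norm_num, Real.log_pow]
    push_cast
    ring
  have h1 : F 1 = Real.pi / 2 := hurwitzZetaOdd_quarter_one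
  simp only [Pi.mul_apply, sub_self, mul_one, Complex.sin_pi_div_two, Complex.cos_pi_div_two,
    Complex.Gamma_one, hlog, h1, zero_mul, mul_zero, add_zero, Complex.cpow_neg_one] at e
  push_cast at e h0
  field_simp at e
  linear_combination (-Real.pi : ℂ) * h0 - (1 / 8 : ℂ) * e

theorem mainTheorem3 :
    stieltjesGamma 1 (1 / 4) =
        1 / 2 * (2 * stieltjesConst 1 - 7 * (Real.log 2 : ℂ) ^ 2
          - 6 * (Real.eulerMascheroniConstant : ℂ) * (Real.log 2 : ℂ))
        - 1 / 2 * (Real.pi : ℂ) * ((Real.eulerMascheroniConstant : ℂ) + 4 * (Real.log 2 : ℂ)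
          + 3 * (Real.log Real.pi : ℂ) - 4 * (Real.log (Real.Gamma (1 / 4)) : ℂ)) ∧
    stieltjesGamma 1 (3 / 4) =
        1 / 2 * (2 * stieltjesConst 1 - 7 * (Real.log 2 : ℂ) ^ 2
          - 6 * (Real.eulerMascheroniConstant : ℂ) * (Real.log 2 : ℂ))
        + 1 / 2 * (Real.pi : ℂ) * ((Real.eulerMascheroniConstant : ℂ) + 4 * (Real.log 2 : ℂ)
          + 3 * (Real.log Real.pi : ℂ) - 4 * (Real.log (Real.Gamma (1 / 4)) : ℂ)) := by
  have h1 := stieltjesGamma_one_quarter_add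
  have h2 := stieltjesGamma_one_quarter_sub
  rw [deriv_hurwitzZetaOdd_quarter_one] at h2
  constructor
  · linear_combination (1 / 2) * h1 + (1 / 2) * h2
  · linear_combination (1 / 2) * h1 - (1 / 2) * h2
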